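/- Let $\mathbb N=\{1,2,\dots\}$. For $M\subseteq\mathbb N$ let $[M]^{<\omega}$ be the set of finite subsets of $M$, and for $\mathcal F\subseteq[\mathbb N]^{<\omega}$ put $\mathcal F[M]=\mathcal F\cap[M]^{<\omega}$. The family $\mathcal F$ is hereditary if $t\subseteq s\in\mathcal F$ implies $t\in\mathcal F$, and pointwise closed if it is closed in $\{0,1\}^{\mathbb N}$ (sets identified with their characteristic functions, product topology). *Strong Cantor–Bendixson index.* For an infinite $M\subseteq\mathbb N$ put $$(\mathcal F)^1_M=\{A\in\mathcal F[M]: A\text{ is a cluster point of }\mathcal F[A\cup L]\text{ for every infinite }L\subseteq M\},$$ where a cluster point of a set is a point all of whose neighbourhoods contain an element of the set other than the point itself. Put $(\mathcal F)^0_M=\mathcal F[M]$, $(\mathcal F)^{\xi+1}_M=((\mathcal F)^\xi_M)^1_M$, and $(\mathcal F)^\xi_M=\bigcap_{\beta<\xi}(\mathcal F)^\beta_M$ for limit $\xi$. For hereditary and pointwise closed $\mathcal F$, $s_M(\mathcal F)$ denotes the smallest countable ordinal $\xi$ with $(\mathcal F)^\xi_M=\emptyset$. *Schreier families.* For every countable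 limit ordinal $\xi$ fix an arbitrary strictly increasing sequence $(\xi_n)_{n\in\mathbb N}$ of ordinals smaller than $\xi$ with supremum $\xi$. Put $\mathcal F_0=\{\{n\}:n\in\mathbb N\}$, $$\mathcal F_{\xi+1}=\Big\{\bigcup_{i=1}^nF_i: n\ge 1,\ n\le \min F_1,\ F_1<\dots<F_n,\ F_i\in\mathcal F_\xi\Big\}$$ (where $F<G$ means $\max F<\min G$), and, for limit $\xi$, $\mathcal F_\xi=\{F: F\in\mathcal F_{\xi_n}\text{ for some }n\le\min F\}$. For an infinite $L=\{\ell_1<\ell_2<\cdots\}\subseteq\mathbb N$ put $\mathcal F_\xi(L)=\{\{\ell_{n_1},\dots,\ell_{n_k}\}:\{n_1,\dots,n_k\}\in\mathcal F_\xi\}$. **Theorem.** Let $\mathcal F$ be a hereditary and pointwise closed family of finite subsets of $\mathbb N$, let $\xi$ be a countable ordinal and let $M\subseteq\mathbb N$ be infinite. If $s_M(\mathcal F)\ge\omega^\xi$ and $s_M(\mathcal F)>1$ (the second condition follows from the first if $\xi\ge1$), then there is an infinite $L\subseteq M$ with $\mathcal F_\xi(L)\subseteq\mathcal F$. -/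

import Mathlib

namespace StrongCB

open Set Filter Topology

/-- The characteristic function of a finite set of positive integers, as a point of `{0,1}^ℕ` with
the product topology (`Bool` is discrete). -/
def chi (s : Finset ℕ+) : ℕ+ → Bool := fun n => decide (n ∈ s)

/-- A family of finite sets is pointwise closed if it is closed in the space of all subsets of the
positive integers, with the topology of pointwise convergence of characteristic functions. -/
def PointwiseClosed (F : Set (Finset ℕ+)) : Prop := IsClosed (chi '' F)

/-- `A` is a cluster point of the family `F`: every neighbourhood of `A` contains a member of `F`
other than `A`. -/
def IsClusterPoint (A : Finset ℕ+) (F : Set (Finset ℕ+)) : Prop := AccPt (chi A) (𝓟 (chi '' F))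

/-- `F[M]`, the members of `F` that are subsets of `M`. -/
def restrict (F : Set (Finset ℕ+)) (M : Set ℕ+) : Set (Finset ℕ+) := {s ∈ F | (s : Set ℕ+) ⊆ M}

/-- The first strong Cantor-Bendixson derivative of `F` on `M`. -/
def strongDeriv (F : Set (Finset ℕ+)) (M : Set ℕ+) : Set (Finset ℕ+) :=
  {A ∈ restrict F M | ∀ L : Set ℕ+, L ⊆ M → L.Infinite → IsClusterPoint A (restrict F (↑A ∪ L))}

/-- The strong Cantor-Bendixson derivatives of `F` on `M`, started with `F[M]` at `0`. -/
noncomputable def iterDeriv (F : Set (Finset ℕ+)) (M : Set ℕ+) (ξ : Ordinal.{0}) :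
    Set (Finset ℕ+) :=
  Ordinal.limitRecOn (motive := fun _ => Set (Finset ℕ+)) ξ (restrict F M)
    (fun _ D => strongDeriv D M)
    (fun ξ _ D => ⋂ (β : Ordinal.{0}) (h : β < ξ), D β h)

theorem iterDeriv_zero (F : Set (Finset ℕ+)) (M : Set ℕ+) :
    iterDeriv F M 0 = restrict F M := by
  simp [iterDeriv]

theorem iterDeriv_succ (F : Set (Finset ℕ+)) (M : Set ℕ+) (ξ : Ordinal.{0}) :
    iterDeriv F M (ξ + 1) = strongDeriv (iterDeriv F M ξ) M := by
  simp [iterDeriv]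

theorem iterDeriv_limit (F : Set (Finset ℕ+)) (M : Set ℕ+) (ξ : Ordinal.{0})
    (h : Order.IsSuccLimit ξ) :
    iterDeriv F M ξ = ⋂ (β : Ordinal.{0}) (_ : β < ξ), iterDeriv F M β := by
  rw [iterDeriv, Ordinal.limitRecOn_limit (h := h)]; rfl

theorem iterDeriv_one (F : Set (Finset ℕ+)) (M : Set ℕ+) :
    iterDeriv F M 1 = strongDeriv F M := by
  have h := iterDeriv_succ F M 0
  rw [zero_add, iterDeriv_zero] at h
  rw [h]
  ext A
  have key : ∀ L : Set ℕ+, (A : Set ℕ+) ⊆ M → L ⊆ M →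
      restrict (restrict F M) (↑A ∪ L) = restrict F (↑A ∪ L) := by
    intro L hA hL
    ext s
    exact ⟨fun hs => ⟨hs.1.1, hs.2⟩, fun hs => ⟨⟨hs.1, hs.2.trans (union_subset hA hL)⟩, hs.2⟩⟩
  constructor
  · rintro ⟨⟨hA, hM⟩, hc⟩
    exact ⟨hA, fun L hL hi => key L hM hL ▸ hc L hL hi⟩
  · rintro ⟨hA, hc⟩
    exact ⟨⟨hA, hA.2⟩, fun L hL hi => (key L hA.2 hL).symm ▸ hc L hL hi⟩

/-- The strong Cantor-Bendixson index `s_M(F)`: the smallest countable ordinal `ξ` for which the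
`ξ`-th derivative is empty (such ordinals exist when `F` is hereditary and pointwise closed and
`M` is infinite). -/
noncomputable def index (F : Set (Finset ℕ+)) (M : Set ℕ+) : Ordinal.{0} :=
  sInf {ξ : Ordinal.{0} | ξ < Ordinal.omega 1 ∧ iterDeriv F M ξ = ∅}

/-- A choice, for every countable limit ordinal `ξ`, of a sequence `ξ_1 < ξ_2 < ⋯` of ordinals
smaller than `ξ` with supremum `ξ`. -/
def IsLadderChoice (a : Ordinal.{0} → ℕ+ → Ordinal.{0}) : Prop :=
  ∀ ξ : Ordinal.{0}, ξ < Ordinal.omega 1 → Order.IsSuccLimit ξ →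
    StrictMono (a ξ) ∧ (∀ n, a ξ n < ξ) ∧ IsLUB (range (a ξ)) ξ

/-- One step of the generalized Schreier families: all unions `F_1 ∪ ⋯ ∪ F_n` with `n ≥ 1`,
`n ≤ F_1 < ⋯ < F_n` and `F_1, …, F_n ∈ S`. -/
def schreierStep (S : Set (Finset ℕ+)) : Set (Finset ℕ+) :=
  {s | ∃ (n : ℕ+) (G : Fin (n : ℕ) → Finset ℕ+),
    (∀ i, G i ∈ S) ∧ (∀ i, ∀ x ∈ G i, n ≤ x) ∧
    (∀ i j, i < j → ∀ x ∈ G i, ∀ y ∈ G j, x < y) ∧ s = Finset.univ.biUnion G}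

/-- The generalized Schreier families `F_ξ` for the choice `a` of sequences. All members of all
the families are non-empty, so `∀ k ∈ s, n ≤ k` says `n ≤ min s`. -/
noncomputable def schreier (a : Ordinal.{0} → ℕ+ → Ordinal.{0}) (ξ : Ordinal.{0}) :
    Set (Finset ℕ+) :=
  Ordinal.limitRecOn (motive := fun _ => Set (Finset ℕ+)) ξ {s | ∃ n : ℕ+, s = {n}}
    (fun _ S => schreierStep S)
    (fun ξ _ S => {s | ∃ (n : ℕ+) (h : a ξ n < ξ), s ∈ S (a ξ n) h ∧ ∀ k ∈ s, n ≤ k})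

theorem schreier_zero (a : Ordinal.{0} → ℕ+ → Ordinal.{0}) :
    schreier a 0 = {s | ∃ n : ℕ+, s = {n}} := by
  simp [schreier]

theorem schreier_succ (a : Ordinal.{0} → ℕ+ → Ordinal.{0}) (ξ : Ordinal.{0}) :
    schreier a (ξ + 1) = schreierStep (schreier a ξ) := by
  simp [schreier]

theorem schreier_limit (a : Ordinal.{0} → ℕ+ → Ordinal.{0}) (ha : IsLadderChoice a)
    (ξ : Ordinal.{0}) (h1 : ξ < Ordinal.omega 1) (h : Order.IsSuccLimit ξ) :
    schreier a ξ = {s | ∃ n : ℕ+, s ∈ schreier a (a ξ n) ∧ ∀ k ∈ s, n ≤ k} := by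
  rw [schreier, Ordinal.limitRecOn_limit (h := h)]
  ext s
  constructor
  · rintro ⟨n, _, hs⟩
    exact ⟨n, hs⟩
  · rintro ⟨n, hs⟩
    exact ⟨n, (ha ξ h1 h).2.1 n, hs⟩

/-- `F_ξ(L)`: the sets `{ℓ_{n_1}, …, ℓ_{n_k}}` with `{n_1, …, n_k} ∈ F_ξ`, where
`ℓ_1 < ℓ_2 < ⋯` is the increasing enumeration of the infinite set `L` (it exists and is unique). -/
def schreierOn (a : Ordinal.{0} → ℕ+ → Ordinal.{0}) (ξ : Ordinal.{0}) (L : Set ℕ+) :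
    Set (Finset ℕ+) :=
  {t | ∃ l : ℕ+ → ℕ+, StrictMono l ∧ range l = L ∧ ∃ s ∈ schreier a ξ, t = s.image l}

theorem existsUnique_enumeration (L : Set ℕ+) (hL : L.Infinite) :
    ∃! l : ℕ+ → ℕ+, StrictMono l ∧ range l = L := by
  let e : ℕ ≃o ℕ+ := OrderIso.pnatIsoNat.symm
  let S : Set ℕ := e ⁻¹' L
  have hS : S.Infinite := hL.preimage (by simp [e.surjective.range_eq])
  have hmono : StrictMono fun n => e (Nat.nth (· ∈ S) (e.symm n)) := fun m n h =>
    e.strictMono (Nat.nth_strictMono hS (e.symm.strictMono h))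
  have hrange : range (fun n => e (Nat.nth (· ∈ S) (e.symm n))) = L := by
    ext x
    constructor
    · rintro ⟨n, rfl⟩
      exact Nat.nth_mem_of_infinite hS (e.symm n)
    · intro hx
      have hx' : e.symm x ∈ range (Nat.nth (· ∈ S)) := by
        refine (Nat.range_nth_of_infinite (p := (· ∈ S)) hS).symm ▸ ?_
        simpa [S] using hx
      obtain ⟨k, hk⟩ := hx'
      exact ⟨e k, by simp [hk]⟩
  refine ⟨_, ⟨hmono, hrange⟩, ?_⟩
  rintro l ⟨h1, h2⟩
  exact (StrictMono.range_inj h1 hmono).1 (h2.trans hrange.symm)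

end StrongCB

namespace StrongCB

open Set Filter Topology

/-! For hereditary `F`, a set lies in the strong derivative exactly when almost every element of `M`
extends it within `F` (`mem_strongDeriv_iff`). So if `∅` survives to stage `β + 1`, then for almost
every `m` the set `{m}` survives to stage `β`, and hence `∅` survives to stage `β` in the link of
`m`, on every subset of `M` (`mem_iterDeriv_link`). The tree of initial segments of the Schreier
family at `ξ` has rank at most `ω ^ ξ` (`rankLE_schreier`), while `∅` lies in the derivative of
order `ω ^ ξ`. Induction on the rank then embeds the family (`RankLE.exists_image_mem`): the rank
drops in each section, the section at `n` is embedded into the link of a chosen element, and the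
choices are diagonalized. The diagonal sequence only moves indices to the right, which is harmless
because Schreier families are spreading. -/

/-! ### Strong derivatives of hereditary families. -/

theorem tendsto_chi_insert (A : Finset ℕ+) :
    Tendsto (fun n => chi (insert n A)) cofinite (𝓝 (chi A)) := by
  rw [tendsto_pi_nhds]
  intro x
  refine tendsto_const_nhds.congr' ?_
  filter_upwards [(Set.finite_singleton x).eventually_cofinite_notMem] with n hn
  rw [mem_singleton_iff] at hn
  simp [chi, Ne.symm hn]

theorem eventually_subset_of_chi (A : Finset ℕ+) :
    ∀ᶠ g in 𝓝 (chi A), ∀ x ∈ A, g x = true := by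
  rw [Filter.eventually_all_finset]
  intro x hx
  have h : Tendsto (fun g : ℕ+ → Bool => g x) (𝓝 (chi A)) (𝓝 (chi A x)) :=
    (continuous_apply x).tendsto _
  rw [nhds_discrete Bool, tendsto_pure] at h
  filter_upwards [h] with g hg
  simpa [chi, hx] using hg

/-- For a lower set, the strong derivative consists of the sets that can be extended by almost
every element of `M`. -/
theorem mem_strongDeriv_iff {F : Set (Finset ℕ+)} (hF : IsLowerSet F) {M : Set ℕ+}
    {A : Finset ℕ+} :
    A ∈ strongDeriv F M ↔ A ∈ restrict F M ∧ {n ∈ M | insert n A ∉ F}.Finite := by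
  refine and_congr_right fun hA => ⟨fun h => ?_, fun h L hL hLi => ?_⟩
  · by_contra hinf
    -- The test set `L` consists of the elements that fail to extend `A`; a member of `F` close to
    -- `A` contains `A` and one of them, against heredity.
    have hc := h _ (sep_subset _ _) hinf
    rw [IsClusterPoint, accPt_iff_frequently] at hc
    obtain ⟨_, ⟨hne, B, hB, rfl⟩, hAB⟩ := (hc.and_eventually (eventually_subset_of_chi A)).exists
    have hsub : A ⊆ B := fun x hx => by simpa [chi] using hAB x hx
    obtain ⟨b, hbB, hbA⟩ : ∃ b ∈ B, b ∉ A := by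
      by_contra! hBA
      exact hne (congrArg chi (Finset.Subset.antisymm hBA hsub))
    rcases hB.2 hbB with hb | hb
    · exact hbA hb
    · exact hb.2 (hF (Finset.insert_subset hbB hsub) hB.1)
  · rw [IsClusterPoint, accPt_iff_frequently]
    have hev : ∀ᶠ n in cofinite, n ∉ A ∧ n ∉ {n ∈ M | insert n A ∉ F} :=
      A.finite_toSet.eventually_cofinite_notMem.and h.eventually_cofinite_notMem
    have hfr : ∃ᶠ n in cofinite, n ∈ L := Filter.frequently_cofinite_iff_infinite.2 hLi
    refine (tendsto_chi_insert A).frequently ((hfr.and_eventually hev).mono ?_)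
    rintro n ⟨hnL, hnA, hn⟩
    have hnF : insert n A ∈ F := by
      by_contra hc
      exact hn ⟨hL hnL, hc⟩
    refine ⟨fun he => hnA ?_, insert n A, ⟨hnF, ?_⟩, rfl⟩
    · have := congrFun he n
      simpa [chi] using this.symm
    · rw [Finset.coe_insert]
      exact insert_subset (Or.inr hnL) subset_union_left

theorem isLowerSet_restrict {F : Set (Finset ℕ+)} (hF : IsLowerSet F) (M : Set ℕ+) :
    IsLowerSet (restrict F M) :=
  fun _ _ hts hs => ⟨hF hts hs.1, fun _ hx => hs.2 (hts hx)⟩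

theorem isLowerSet_strongDeriv {F : Set (Finset ℕ+)} (hF : IsLowerSet F) (M : Set ℕ+) :
    IsLowerSet (strongDeriv F M) := by
  intro s t hts hs
  rw [mem_strongDeriv_iff hF] at hs ⊢
  refine ⟨isLowerSet_restrict hF M hts hs.1, hs.2.subset ?_⟩
  rintro n ⟨hn, hnt⟩
  exact ⟨hn, fun h => hnt (hF (Finset.insert_subset_insert n hts) h)⟩

theorem isLowerSet_iterDeriv {F : Set (Finset ℕ+)} (hF : IsLowerSet F) (M : Set ℕ+)
    (ξ : Ordinal.{0}) : IsLowerSet (iterDeriv F M ξ) := by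
  induction ξ using Ordinal.limitRecOn with
  | zero => rw [iterDeriv_zero]; exact isLowerSet_restrict hF M
  | add_one ξ ih =>
    rw [iterDeriv_succ]
    exact isLowerSet_strongDeriv ih M
  | limit ξ hξ ih =>
    rw [iterDeriv_limit F M ξ hξ]
    exact isLowerSet_iInter₂ ih

theorem iterDeriv_antitone (F : Set (Finset ℕ+)) (M : Set ℕ+) : Antitone (iterDeriv F M) := by
  intro β ξ h
  induction ξ using Ordinal.limitRecOn with
  | zero => rw [nonpos_iff_eq_zero.1 h]
  | add_one ξ ih =>
    rcases h.eq_or_lt with rfl | h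
    · exact le_rfl
    · rw [iterDeriv_succ]
      exact fun A hA => ih (Order.lt_succ_iff.1 h) hA.1.1
  | limit ξ hξ ih =>
    rcases h.eq_or_lt with rfl | h
    · exact le_rfl
    · rw [iterDeriv_limit F M ξ hξ]
      exact iInter₂_subset β h

theorem iterDeriv_subset_restrict (F : Set (Finset ℕ+)) (M : Set ℕ+) (ξ : Ordinal.{0}) :
    iterDeriv F M ξ ⊆ restrict F M := by
  rw [← iterDeriv_zero]
  exact iterDeriv_antitone F M zero_le

/-- The sets whose extension by `m` belongs to `F`. -/
def link (F : Set (Finset ℕ+)) (m : ℕ+) : Set (Finset ℕ+) := {s | insert m s ∈ F}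

theorem isLowerSet_link {F : Set (Finset ℕ+)} (hF : IsLowerSet F) (m : ℕ+) :
    IsLowerSet (link F m) :=
  fun _ _ hts hs => hF (Finset.insert_subset_insert m hts) hs

theorem mem_iterDeriv_link {F : Set (Finset ℕ+)} (hF : IsLowerSet F) {M N : Set ℕ+} (hN : N ⊆ M)
    (m : ℕ+) (ξ : Ordinal.{0}) :
    ∀ A : Finset ℕ+, (A : Set ℕ+) ⊆ N → insert m A ∈ iterDeriv F M ξ →
      A ∈ iterDeriv (link F m) N ξ := by
  induction ξ using Ordinal.limitRecOn with
  | zero =>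
    intro A hA h
    rw [iterDeriv_zero] at h ⊢
    exact ⟨h.1, hA⟩
  | add_one ξ ih =>
    intro A hA h
    rw [iterDeriv_succ, mem_strongDeriv_iff (isLowerSet_iterDeriv hF M ξ)] at h
    rw [iterDeriv_succ, mem_strongDeriv_iff (isLowerSet_iterDeriv (isLowerSet_link hF m) N ξ)]
    refine ⟨⟨ih A hA h.1.1, hA⟩, h.2.subset ?_⟩
    rintro n ⟨hn, hnA⟩
    refine ⟨hN hn, fun hc => hnA (ih _ ?_ ?_)⟩
    · rw [Finset.coe_insert]
      exact insert_subset hn hA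
    · rwa [Finset.insert_comm]
  | limit ξ hξ ih =>
    intro A hA h
    rw [iterDeriv_limit _ _ ξ hξ, mem_iInter₂] at h ⊢
    exact fun β hβ => ih β hβ A hA (h β hβ)

/-! ### Ranks of trees of initial segments. -/

/-- The sets that lie to the right of `n` and become a member of `S` when `n` is added. -/
def rightSection (S : Set (Finset ℕ+)) (n : ℕ+) : Set (Finset ℕ+) :=
  {s | insert n s ∈ S ∧ ∀ x ∈ s, n < x}

/-- The tree of initial segments of members of `S` has rank at most `α`. -/
inductive RankLE : Set (Finset ℕ+) → Ordinal.{0} → Prop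
  | intro (S : Set (Finset ℕ+)) (α : Ordinal.{0}) (β : ℕ+ → Ordinal.{0})
      (hβ : ∀ n, (rightSection S n).Nonempty → β n < α)
      (h : ∀ n, (rightSection S n).Nonempty → RankLE (rightSection S n) (β n)) : RankLE S α

theorem RankLE.exists_lt {S : Set (Finset ℕ+)} {α : Ordinal.{0}} (h : RankLE S α) (n : ℕ+)
    (hn : (rightSection S n).Nonempty) : ∃ β < α, RankLE (rightSection S n) β := by
  obtain ⟨_, _, β, hβ, h⟩ := h
  exact ⟨β n, hβ n hn, h n hn⟩

theorem rankLE_of_forall {S : Set (Finset ℕ+)} {α : Ordinal.{0}}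
    (h : ∀ n, (rightSection S n).Nonempty → ∃ β < α, RankLE (rightSection S n) β) :
    RankLE S α := by
  choose! β hβ using h
  exact ⟨S, α, β, fun n hn => (hβ n hn).1, fun n hn => (hβ n hn).2⟩

theorem rightSection_mono {S T : Set (Finset ℕ+)} (h : S ⊆ T) (n : ℕ+) :
    rightSection S n ⊆ rightSection T n :=
  fun _ hs => ⟨h hs.1, hs.2⟩

theorem rightSection_union (S T : Set (Finset ℕ+)) (n : ℕ+) :
    rightSection (S ∪ T) n = rightSection S n ∪ rightSection T n := by
  ext s
  exact or_and_right

theorem RankLE.mono {T : Set (Finset ℕ+)} {β : Ordinal.{0}} (hT : RankLE T β) :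
    ∀ {S : Set (Finset ℕ+)} {α : Ordinal.{0}}, S ⊆ T → β ≤ α → RankLE S α := by
  induction hT with
  | intro T β γ hγ _ ih =>
    intro S α hST hβα
    refine ⟨S, α, γ, fun n hn => ?_, fun n hn => ?_⟩
    · exact (hγ n (hn.mono (rightSection_mono hST n))).trans_le hβα
    · exact ih n (hn.mono (rightSection_mono hST n)) (rightSection_mono hST n) le_rfl

theorem rankLE_empty (α : Ordinal.{0}) : RankLE ∅ α :=
  rankLE_of_forall fun _ ⟨_, hs⟩ => hs.1.elim

theorem rankLE_singleton_empty (α : Ordinal.{0}) : RankLE {∅} α :=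
  rankLE_of_forall fun _ ⟨_, hs⟩ => (Finset.insert_ne_empty _ _ hs.1).elim

theorem RankLE.rightSection {S : Set (Finset ℕ+)} {α : Ordinal.{0}} (h : RankLE S α) (n : ℕ+) :
    RankLE (rightSection S n) α := by
  rcases (StrongCB.rightSection S n).eq_empty_or_nonempty with he | hn
  · rw [he]
    exact rankLE_empty α
  · obtain ⟨β, hβ, h'⟩ := h.exists_lt n hn
    exact h'.mono subset_rfl hβ.le

/-- Sections commute with unions, so ranks combine by maximum, with no loss. This keeps finite
unions below a limit rank. -/
theorem RankLE.union_max {S : Set (Finset ℕ+)} {α : Ordinal.{0}} (hS : RankLE S α) :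
    ∀ {T : Set (Finset ℕ+)} {β : Ordinal.{0}}, RankLE T β → RankLE (S ∪ T) (max α β) := by
  induction hS with
  | intro S α γ hγ hS ih =>
    intro T β hT
    refine rankLE_of_forall fun n _ => ?_
    rw [rightSection_union]
    rcases (StrongCB.rightSection S n).eq_empty_or_nonempty with hSe | hSn
    · rcases (StrongCB.rightSection T n).eq_empty_or_nonempty with hTe | hTn
      · simp_all [rightSection_union]
      · rw [hSe, empty_union]
        obtain ⟨δ, hδ, h⟩ := hT.exists_lt n hTn
        exact ⟨δ, lt_max_of_lt_right hδ, h⟩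
    · rcases (StrongCB.rightSection T n).eq_empty_or_nonempty with hTe | hTn
      · rw [hTe, union_empty]
        exact ⟨γ n, lt_max_of_lt_left (hγ n hSn), hS n hSn⟩
      · obtain ⟨δ, hδ, h⟩ := hT.exists_lt n hTn
        exact ⟨_, max_lt_max (hγ n hSn) hδ, ih n hSn h⟩

theorem RankLE.union {S T : Set (Finset ℕ+)} {α : Ordinal.{0}} (hS : RankLE S α)
    (hT : RankLE T α) : RankLE (S ∪ T) α := by
  simpa using hS.union_max hT

theorem rankLE_biUnion {ι : Type*} (t : Finset ι) {S : ι → Set (Finset ℕ+)} {α : Ordinal.{0}}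
    (h : ∀ i ∈ t, RankLE (S i) α) : RankLE (⋃ i ∈ t, S i) α := by
  classical
  induction t using Finset.induction_on with
  | empty => simpa using rankLE_empty α
  | insert i t _ ih =>
    rw [Finset.set_biUnion_insert]
    exact (h i (Finset.mem_insert_self i t)).union
      (ih fun j hj => h j (Finset.mem_insert_of_mem hj))

/-! ### Successive blocks and the rank of Schreier families. -/

/-- The unions `s ∪ t` with `s ∈ S`, `t ∈ T` and `s < t`. -/
def blockSum (S T : Set (Finset ℕ+)) : Set (Finset ℕ+) :=
  {u | ∃ s ∈ S, ∃ t ∈ T, (∀ x ∈ s, ∀ y ∈ t, x < y) ∧ u = s ∪ t}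

/-- The least element `n` of `s ∪ t` either belongs to `s`, or `s` is empty and `n` is the least
element of `t`. -/
theorem rightSection_blockSum_subset (S T : Set (Finset ℕ+)) (n : ℕ+) :
    rightSection (blockSum S T) n ⊆ blockSum (rightSection S n) T ∪ rightSection T n := by
  rintro u ⟨⟨s, hs, t, ht, hst, hu⟩, hnu⟩
  have hnu' : n ∉ u := fun h => lt_irrefl _ (hnu n h)
  have hmem : ∀ x ∈ s ∪ t, x ≠ n → n < x := by
    intro x hx hxn
    rw [← hu, Finset.mem_insert] at hx
    exact hnu x (hx.resolve_left hxn)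
  have hns : n ∈ s ∪ t := hu ▸ Finset.mem_insert_self n u
  by_cases hn : n ∈ s
  · have hnt : n ∉ t := fun h => lt_irrefl _ (hst n hn n h)
    refine Or.inl ⟨s.erase n, ⟨?_, ?_⟩, t, ht, fun x hx => hst x (Finset.mem_of_mem_erase hx), ?_⟩
    · rwa [Finset.insert_erase hn]
    · exact fun x hx => hmem x (Finset.mem_union_left _ (Finset.mem_of_mem_erase hx))
        (Finset.ne_of_mem_erase hx)
    · rw [← Finset.erase_insert hnu', hu, Finset.erase_union_distrib, Finset.erase_eq_of_notMem hnt]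
  · have hnt : n ∈ t := (Finset.mem_union.1 hns).resolve_left hn
    have hse : s = ∅ := by
      refine Finset.eq_empty_of_forall_notMem fun x hx => ?_
      exact lt_asymm (hst x hx n hnt)
        (hmem x (Finset.mem_union_left _ hx) fun h => hn (h ▸ hx))
    refine Or.inr ⟨?_, hnu⟩
    rwa [hu, hse, Finset.empty_union]

/-- The first block is consumed first, so its rank is the right summand, in which ordinal addition
is strictly increasing. -/
theorem RankLE.blockSum {S T : Set (Finset ℕ+)} {α β : Ordinal.{0}} (hS : RankLE S α)
    (hT : RankLE T β) : RankLE (blockSum S T) (β + α) := by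
  induction hS with
  | intro S α γ hγ _ ih =>
    refine rankLE_of_forall fun n hn => ?_
    have hsub := rightSection_blockSum_subset S T n
    rcases (StrongCB.rightSection S n).eq_empty_or_nonempty with hSe | hSn
    · have he : StrongCB.blockSum ∅ T = ∅ :=
        eq_empty_of_forall_notMem fun _ ⟨_, hs, _⟩ => hs.elim
      rw [hSe, he, empty_union] at hsub
      obtain ⟨δ, hδ, h⟩ := hT.exists_lt n (hn.mono hsub)
      exact ⟨δ, hδ.trans_le (le_add_of_nonneg_right zero_le), h.mono hsub le_rfl⟩
    · refine ⟨β + γ n, (add_lt_add_iff_left β).2 (hγ n hSn), RankLE.mono ?_ hsub le_rfl⟩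
      exact (ih n hSn).union ((hT.rightSection n).mono subset_rfl (le_add_of_nonneg_right zero_le))

/-- The unions of `k` successive members of `S`, some of which may be empty. -/
def blockPow (S : Set (Finset ℕ+)) : ℕ → Set (Finset ℕ+)
  | 0 => {∅}
  | k + 1 => blockSum (S ∪ {∅}) (blockPow S k)

theorem RankLE.blockPow {S : Set (Finset ℕ+)} {α : Ordinal.{0}} (hS : RankLE S α) (k : ℕ) :
    RankLE (blockPow S k) (α * k) := by
  induction k with
  | zero => exact rankLE_singleton_empty _
  | succ k ih =>
    rw [Nat.cast_succ, mul_add_one]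
    exact (hS.union (rankLE_singleton_empty α)).blockSum ih

theorem blockPow_monotone (S : Set (Finset ℕ+)) : Monotone (blockPow S) :=
  monotone_nat_of_le_succ fun k t ht =>
    ⟨∅, Or.inr rfl, t, ht, fun x hx => (Finset.notMem_empty x hx).elim, by simp⟩

theorem biUnion_mem_blockPow {S : Set (Finset ℕ+)} :
    ∀ {k : ℕ} {G : Fin k → Finset ℕ+}, (∀ i, G i ∈ S) →
      (∀ i j, i < j → ∀ x ∈ G i, ∀ y ∈ G j, x < y) → Finset.univ.biUnion G ∈ blockPow S k
  | 0, G, _, _ => by simp [blockPow]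
  | k + 1, G, hG, hlt => by
    refine ⟨G 0, Or.inl (hG 0), Finset.univ.biUnion fun i : Fin k => G i.succ,
      biUnion_mem_blockPow (fun i => hG _) fun i j hij => hlt _ _ (Fin.succ_lt_succ_iff.2 hij),
      ?_, ?_⟩
    · intro x hx y hy
      obtain ⟨i, -, hi⟩ := Finset.mem_biUnion.1 hy
      exact hlt 0 i.succ (Fin.succ_pos i) x hx y hi
    · ext x
      simp [Fin.exists_fin_succ]

/-- Fixing the element `n` bounds the number of blocks by `n`, which is what keeps the section's
rank below the next power of `ω`. -/
theorem rightSection_schreierStep_subset (S : Set (Finset ℕ+)) (n : ℕ+) :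
    rightSection (schreierStep S) n ⊆ rightSection (blockPow S n) n := by
  rintro s ⟨⟨k, G, hG, hk, hlt, hs⟩, hns⟩
  refine ⟨?_, hns⟩
  have hkn : k ≤ n := by
    obtain ⟨i, -, hi⟩ := Finset.mem_biUnion.1 (hs ▸ Finset.mem_insert_self n s)
    exact hk i n hi
  rw [hs]
  exact blockPow_monotone S hkn (biUnion_mem_blockPow hG hlt)

theorem rankLE_schreier {a : Ordinal.{0} → ℕ+ → Ordinal.{0}} (ha : IsLadderChoice a)
    {ξ : Ordinal.{0}} (hξ : ξ < Ordinal.omega 1) : RankLE (schreier a ξ) (Ordinal.omega0 ^ ξ) := by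
  induction ξ using Ordinal.limitRecOn with
  | zero =>
    rw [Ordinal.opow_zero, schreier_zero]
    refine rankLE_of_forall fun n _ => ⟨0, zero_lt_one, (rankLE_singleton_empty 0).mono ?_ le_rfl⟩
    rintro s ⟨⟨m, hm⟩, hn⟩
    refine Finset.eq_empty_of_forall_notMem fun x hx => (hn x hx).ne ?_
    have h1 : n ∈ ({m} : Finset ℕ+) := hm ▸ Finset.mem_insert_self n s
    have h2 : x ∈ ({m} : Finset ℕ+) := hm ▸ Finset.mem_insert_of_mem hx
    rw [Finset.mem_singleton.1 h1, Finset.mem_singleton.1 h2]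
  | add_one ξ ih =>
    rw [schreier_succ, ← Order.succ_eq_add_one, Ordinal.opow_succ]
    have ih := ih ((Order.lt_succ ξ).trans hξ)
    refine rankLE_of_forall fun n _ => ⟨Ordinal.omega0 ^ ξ * (n : ℕ), ?_, ?_⟩
    · exact (mul_lt_mul_iff_right₀ (Ordinal.opow_pos ξ Ordinal.omega0_pos)).2
        (Ordinal.natCast_lt_omega0 n)
    · exact ((ih.blockPow n).rightSection n).mono (rightSection_schreierStep_subset _ n) le_rfl
  | limit ξ hlim ih =>
    rw [schreier_limit a ha ξ hξ hlim]
    obtain ⟨hmono, hlt, -⟩ := ha ξ hξ hlim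
    refine rankLE_of_forall fun n _ => ⟨Ordinal.omega0 ^ a ξ n,
      (Ordinal.opow_lt_opow_iff_right Ordinal.one_lt_omega0).2 (hlt n), ?_⟩
    -- A set containing `n` can only enter through an index `k ≤ n`, so finitely many earlier
    -- families cover the section.
    have hU : RankLE (⋃ k ∈ Finset.Iic n, schreier a (a ξ k)) (Ordinal.omega0 ^ a ξ n) :=
      rankLE_biUnion _ fun k hk => (ih _ (hlt k) ((hlt k).trans hξ)).mono subset_rfl
        (Ordinal.opow_le_opow_right Ordinal.omega0_pos (hmono.monotone (Finset.mem_Iic.1 hk)))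
    refine (hU.rightSection n).mono ?_ le_rfl
    rintro s ⟨⟨k, hs, hk⟩, hns⟩
    exact ⟨mem_biUnion (Finset.mem_Iic.2 (hk n (Finset.mem_insert_self n s))) hs, hns⟩

/-! ### Spreading families. -/

/-- A family is spreading if it contains with a set every set obtained by moving its elements to
the right. -/
def IsSpreading (S : Set (Finset ℕ+)) : Prop :=
  ∀ s ∈ S, ∀ f : ℕ+ → ℕ+, StrictMonoOn f s → (∀ x ∈ s, x ≤ f x) → s.image f ∈ S

theorem IsSpreading.schreierStep {S : Set (Finset ℕ+)} (hS : IsSpreading S) :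
    IsSpreading (schreierStep S) := by
  rintro _ ⟨n, G, hG, hn, hlt, rfl⟩ f hf hle
  have hsub : ∀ i, ∀ x ∈ G i, x ∈ Finset.univ.biUnion G := fun i x hx =>
    Finset.mem_biUnion.2 ⟨i, Finset.mem_univ i, hx⟩
  refine ⟨n, fun i => (G i).image f, fun i => hS _ (hG i) f (hf.mono (hsub i)) fun x hx =>
    hle x (hsub i x hx), ?_, ?_, Finset.biUnion_image⟩
  · intro i y hy
    obtain ⟨x, hx, rfl⟩ := Finset.mem_image.1 hy
    exact (hn i x hx).trans (hle x (hsub i x hx))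
  · intro i j hij y hy z hz
    obtain ⟨x, hx, rfl⟩ := Finset.mem_image.1 hy
    obtain ⟨w, hw, rfl⟩ := Finset.mem_image.1 hz
    exact hf (hsub i x hx) (hsub j w hw) (hlt i j hij x hx w hw)

theorem isSpreading_schreier {a : Ordinal.{0} → ℕ+ → Ordinal.{0}} (ha : IsLadderChoice a)
    {ξ : Ordinal.{0}} (hξ : ξ < Ordinal.omega 1) : IsSpreading (schreier a ξ) := by
  induction ξ using Ordinal.limitRecOn with
  | zero =>
    rw [schreier_zero]
    rintro _ ⟨n, rfl⟩ f - -
    exact ⟨f n, Finset.image_singleton f n⟩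
  | add_one ξ ih =>
    rw [schreier_succ]
    exact (ih ((Order.lt_succ ξ).trans hξ)).schreierStep
  | limit ξ hlim ih =>
    rw [schreier_limit a ha ξ hξ hlim]
    have hlt := (ha ξ hξ hlim).2.1
    rintro s ⟨n, hs, hn⟩ f hf hle
    refine ⟨n, ih _ (hlt n) ((hlt n).trans hξ) s hs f hf hle, ?_⟩
    intro y hy
    obtain ⟨x, hx, rfl⟩ := Finset.mem_image.1 hy
    exact (hn x hx).trans (hle x hx)

theorem IsSpreading.rightSection {S : Set (Finset ℕ+)} (hS : IsSpreading S) (n : ℕ+) :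
    IsSpreading (rightSection S n) := by
  rintro s ⟨hs, hns⟩ f hf hle
  have hne : ∀ x ∈ s, x ≠ n := fun x hx => (hns x hx).ne'
  -- The shift is extended to `insert n s` by fixing `n`, which stays to the left.
  have himg : s.image (Function.update f n n) = s.image f :=
    Finset.image_congr fun x hx => Function.update_of_ne (hne x hx) _ _
  refine ⟨?_, ?_⟩
  · have h := hS _ hs (Function.update f n n) ?_ ?_
    · rwa [Finset.image_insert, Function.update_self, himg] at h
    · rw [Finset.coe_insert]
      rintro x (rfl | hx) y (rfl | hy) hxy
      · exact (lt_irrefl _ hxy).elim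
      · rw [Function.update_self, Function.update_of_ne (hne y hy)]
        exact hxy.trans_le (hle y hy)
      · exact (lt_asymm hxy (hns x hx)).elim
      · rw [Function.update_of_ne (hne x hx), Function.update_of_ne (hne y hy)]
        exact hf hx hy hxy
    · intro x hx
      rcases Finset.mem_insert.1 hx with rfl | hx
      · rw [Function.update_self]
      · rw [Function.update_of_ne (hne x hx)]
        exact hle x hx
  · intro y hy
    obtain ⟨x, hx, rfl⟩ := Finset.mem_image.1 hy
    exact (hns x hx).trans_le (hle x hx)

/-! ### Diagonal embedding. -/

/-- One step of the diagonal construction: a new element `q.1` of the sequence `p.2` and a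
subsequence `q.2` of `p.2` that maps the section of `S` at `n` into the link of `q.1`. -/
def DiagonalStep (S F : Set (Finset ℕ+)) (n : ℕ+) (p q : ℕ+ × (ℕ+ → ℕ+)) : Prop :=
  StrictMono q.2 ∧ range q.2 ⊆ range p.2 ∧ (∀ i, p.2 i ≤ q.2 i) ∧ q.1 ∈ range p.2 ∧
    p.2 n ≤ q.1 ∧ p.1 < q.1 ∧ ∀ s ∈ rightSection S n, insert q.1 (s.image q.2) ∈ F

theorem exists_image_mem_of_diagonalStep {S F : Set (Finset ℕ+)} (hS : IsSpreading S)
    (hF : ∅ ∈ F) (l : ℕ+ → ℕ+) (hl : StrictMono l)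
    (h : ∀ n p, StrictMono p.2 → range p.2 ⊆ range l → ∃ q, DiagonalStep S F n p q) :
    ∃ l' : ℕ+ → ℕ+, StrictMono l' ∧ range l' ⊆ range l ∧ ∀ s ∈ S, s.image l' ∈ F := by
  choose! next hnext using h
  let st : ℕ → ℕ+ × (ℕ+ → ℕ+) := fun k => k.rec (1, l) fun k p => next k.succPNat p
  have hinv : ∀ k, StrictMono (st k).2 ∧ range (st k).2 ⊆ range l := by
    intro k
    induction k with
    | zero => exact ⟨hl, subset_rfl⟩
    | succ k ih =>
      have hk := hnext k.succPNat (st k) ih.1 ih.2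
      exact ⟨hk.1, hk.2.1.trans ih.2⟩
  have hstep : ∀ k, DiagonalStep S F k.succPNat (st k) (st (k + 1)) := fun k =>
    hnext k.succPNat (st k) (hinv k).1 (hinv k).2
  have hrange : Antitone fun k => range (st k).2 :=
    antitone_nat_of_succ_le fun k => (hstep k).2.1
  have hle : Monotone fun k => (st k).2 := monotone_nat_of_le_succ fun k => (hstep k).2.2.1
  have hfst : StrictMono fun k => (st k).1 := strictMono_nat_of_lt_succ fun k =>
    (hstep k).2.2.2.2.2.1
  let l' : ℕ+ → ℕ+ := fun n => (st n).1
  have hl' : StrictMono l' := fun m n hmn => hfst hmn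
  have hstep' : ∀ n : ℕ+, DiagonalStep S F n (st n.natPred) (st n) := by
    intro n
    have := hstep n.natPred
    rwa [PNat.succPNat_natPred, PNat.natPred_add_one] at this
  refine ⟨l', hl', ?_, ?_⟩
  · rintro _ ⟨n, rfl⟩
    exact (hinv _).2 (hstep' n).2.2.2.1
  · intro s hs
    rcases s.eq_empty_or_nonempty with rfl | hne
    · simpa using hF
    set n := s.min' hne with hn
    have hns : n ∈ s := s.min'_mem hne
    have hsec : s.erase n ∈ rightSection S n := by
      refine ⟨by rwa [Finset.insert_erase hns], fun x hx => ?_⟩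
      exact lt_of_le_of_ne (s.min'_le x (Finset.mem_of_mem_erase hx))
        (Finset.ne_of_mem_erase hx).symm
    -- Past `n`, the diagonal is a subsequence of the `n`-th sequence. Hence `l'` on the tail is
    -- `(st n).2` after the right shift `ψ`, and spreading keeps the shifted tail in the section.
    have hψ : ∀ i, n < i → ∃ j, i ≤ j ∧ (st n).2 j = l' i := by
      intro i hi
      have hni : (n : ℕ) ≤ i.natPred := by
        have : (n : ℕ) < i := hi
        have := i.natPred_add_one
        omega
      obtain ⟨j, hj⟩ := hrange hni (hstep' i).2.2.2.1
      refine ⟨j, ?_, hj⟩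
      rw [← (hinv n).1.le_iff_le, hj]
      exact (hle hni i).trans (hstep' i).2.2.2.2.1
    choose! ψ hψ using hψ
    have hψs := hS.rightSection n _ hsec ψ ?_ fun x hx => (hψ x (hsec.2 x hx)).1
    · have himg : ((s.erase n).image ψ).image (st n).2 = (s.erase n).image l' := by
        rw [Finset.image_image]
        exact Finset.image_congr fun x hx => (hψ x (hsec.2 x hx)).2
      have hmem := (hstep' n).2.2.2.2.2.2 _ hψs
      rw [himg] at hmem
      rwa [← Finset.insert_erase hns, Finset.image_insert]
    · intro x hx y hy hxy
      rw [← (hinv n).1.lt_iff_lt, (hψ x (hsec.2 x hx)).2, (hψ y (hsec.2 y hy)).2]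
      exact hl' hxy

theorem le_of_range_subset {f g : ℕ+ → ℕ+} (hf : StrictMono f) (hg : StrictMono g)
    (h : range g ⊆ range f) (i : ℕ+) : f i ≤ g i := by
  choose φ hφ using fun j => h ⟨j, rfl⟩
  have hφm : StrictMono φ := fun j k hjk => by
    rw [← hf.lt_iff_lt, hφ, hφ]
    exact hg hjk
  rw [← hφ i]
  exact hf.monotone hφm.le_apply

/-- `F` and `l` vary inside the induction, since the hypothesis is applied to links and
subsequences. -/
theorem RankLE.exists_image_mem {S : Set (Finset ℕ+)} {α : Ordinal.{0}} (hα : RankLE S α) :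
    IsSpreading S → ∀ {F : Set (Finset ℕ+)}, IsLowerSet F → ∀ {l : ℕ+ → ℕ+}, StrictMono l →
      ∅ ∈ iterDeriv F (range l) α →
      ∃ l' : ℕ+ → ℕ+, StrictMono l' ∧ range l' ⊆ range l ∧ ∀ s ∈ S, s.image l' ∈ F := by
  induction hα with
  | intro S α β hβ _ ih =>
    intro hS F hF l hl h
    refine exists_image_mem_of_diagonalStep hS (iterDeriv_subset_restrict _ _ _ h).1 l hl
      fun n p hp hpl => ?_
    rcases (StrongCB.rightSection S n).eq_empty_or_nonempty with hSe | hSn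
    · refine ⟨(p.2 (n + p.1), p.2), hp, subset_rfl, fun i => le_rfl, ⟨_, rfl⟩,
        hp.monotone (PNat.lt_add_right n p.1).le,
        (PNat.lt_add_left p.1 n).trans_le hp.le_apply, ?_⟩
      simp [hSe]
    · have hsucc := iterDeriv_antitone F (range l) (Order.succ_le_of_lt (hβ n hSn)) h
      rw [Order.succ_eq_add_one, iterDeriv_succ,
        mem_strongDeriv_iff (isLowerSet_iterDeriv hF _ _)] at hsucc
      have hfin := hsucc.2.preimage hp.injective.injOn
      -- Almost every index `k` is admissible; `k > n + p.1` gives both lower bounds required of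
      -- `p.2 k`.
      obtain ⟨k, hk, hkn⟩ := hfin.infinite_compl.exists_gt (n + p.1)
      have hmem : insert (p.2 k) ∅ ∈ iterDeriv F (range l) (β n) := by
        by_contra hc
        exact hk ⟨hpl ⟨k, rfl⟩, hc⟩
      obtain ⟨q, hq, hqp, hqF⟩ := ih n hSn (hS.rightSection n) (isLowerSet_link hF (p.2 k)) hp
        (mem_iterDeriv_link hF hpl (p.2 k) (β n) ∅ (by simp) hmem)
      refine ⟨(p.2 k, q), hq, hqp, fun i => ?_, ⟨k, rfl⟩,
        hp.monotone ((PNat.lt_add_right n p.1).trans hkn).le,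
        ((PNat.lt_add_left p.1 n).trans hkn).trans_le hp.le_apply, hqF⟩
      exact le_of_range_subset hp hq hqp i

/-! ### From the index to the theorem. -/

theorem iterDeriv_nonempty_of_lt_index {F : Set (Finset ℕ+)} {M : Set ℕ+} {β : Ordinal.{0}}
    (h : β < index F M) : (iterDeriv F M β).Nonempty := by
  rw [nonempty_iff_ne_empty]
  intro he
  have hne : {ξ : Ordinal.{0} | ξ < Ordinal.omega 1 ∧ iterDeriv F M ξ = ∅}.Nonempty := by
    by_contra hc
    -- The infimum of the empty set is `0`, which exceeds no `β`.
    rw [index, not_nonempty_iff_eq_empty.1 hc, Ordinal.sInf_empty] at h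
    exact not_lt_zero h
  exact notMem_of_lt_csInf' h ⟨h.trans (csInf_mem hne).1, he⟩

/-- By heredity `∅` lies in every derivative below the index. For `ξ ≠ 0` the ordinal `ω ^ ξ` is a
limit, so `∅` survives to that stage itself; for `ξ = 0` stage `1` needs `hs1`. -/
theorem empty_mem_iterDeriv_omega0_opow {F : Set (Finset ℕ+)} (hF : IsLowerSet F) {M : Set ℕ+}
    {ξ : Ordinal.{0}} (hs : Ordinal.omega0 ^ ξ ≤ index F M) (hs1 : 1 < index F M) :
    ∅ ∈ iterDeriv F M (Ordinal.omega0 ^ ξ) := by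
  have key : ∀ β < index F M, ∅ ∈ iterDeriv F M β := fun β hβ =>
    (iterDeriv_nonempty_of_lt_index hβ).elim fun A hA =>
      isLowerSet_iterDeriv hF M β (Finset.empty_subset A) hA
  rcases eq_or_ne ξ 0 with rfl | hξ
  · rw [Ordinal.opow_zero]
    exact key 1 hs1
  · rw [iterDeriv_limit _ _ _ (Ordinal.isSuccLimit_opow_left Ordinal.isSuccLimit_omega0 hξ)]
    exact mem_iInter₂.2 fun β hβ => key β (hβ.trans_le hs)

end StrongCB

theorem mainTheorem9 (a : Ordinal.{0} → ℕ+ → Ordinal.{0}) (ha : StrongCB.IsLadderChoice a)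
    (F : Set (Finset ℕ+)) (hF : IsLowerSet F) (hFc : StrongCB.PointwiseClosed F)
    (ξ : Ordinal.{0}) (hξ : ξ < Ordinal.omega 1)
    (M : Set ℕ+) (hM : M.Infinite)
    (hs : Ordinal.omega0 ^ ξ ≤ StrongCB.index F M) (hs1 : 1 < StrongCB.index F M) :
    ∃ L : Set ℕ+, L ⊆ M ∧ L.Infinite ∧ StrongCB.schreierOn a ξ L ⊆ F := by
  obtain ⟨m, ⟨hm, rfl⟩, -⟩ := StrongCB.existsUnique_enumeration M hM
  obtain ⟨l, hl, hlm, hlF⟩ := (StrongCB.rankLE_schreier ha hξ).exists_image_mem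
    (StrongCB.isSpreading_schreier ha hξ) hF hm
    (StrongCB.empty_mem_iterDeriv_omega0_opow hF hs hs1)
  refine ⟨Set.range l, hlm, Set.infinite_range_of_injective hl.injective, ?_⟩
  rintro _ ⟨l', hl', hrange, s, hsS, rfl⟩
  rw [(StrictMono.range_inj hl' hl).1 hrange]
  exact hlF s hsS
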